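/- Let $p$ be a prime number and let $v_p:\mathbb{Q}_p\to\mathbb{Z}\cup\{\infty\}$ be the $p$-adic valuation, with $v_p(0)=\infty$. Let $\mathfrak{Q}_p$ be the first-order structure with domain $\mathbb{Q}_p$ whose signature consists of a binary function symbol $+$, denoting addition, a constant symbol $1$, denoting $1\in\mathbb{Q}_p$, and, for every $c\in\mathbb{Z}$, unary relation symbols $\leq^p_c,\ \geq^p_c,\ =^p_c,\ \neq^p_c$, denoting the sets $\{x: v_p(x)\leq c\}$, $\{x: v_p(x)\geq c\}$, $\{x: v_p(x)=c\}$ and $\{x: v_p(x)\neq c\}$, respectively. Then $\mathfrak{Q}_p$ and its substructure with domain $\mathbb{Q}\subseteq\mathbb{Q}_p$ have the same first-order theory; that is, a first-order sentence in this signature (with equality) holds in $\mathfrak{Q}_p$ if and only if it holds in that substructure. -/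

import Mathlib

open scoped FirstOrder

namespace PadicLinear

/-- The function symbols: a constant symbol `1` and a binary symbol `+`. -/
inductive FuncSymb : ℕ → Type
  | one : FuncSymb 0
  | add : FuncSymb 2

/-- The relation symbols: for every integer `c` four unary symbols, for the valuation constraints
`v(x) ≤ c`, `v(x) ≥ c`, `v(x) = c` and `v(x) ≠ c`. -/
inductive RelSymb : ℕ → Type
  | valLE (c : ℤ) : RelSymb 1
  | valGE (c : ℤ) : RelSymb 1
  | valEQ (c : ℤ) : RelSymb 1
  | valNE (c : ℤ) : RelSymb 1

/-- The signature `{+, 1} ∪ {≤_c, ≥_c, =_c, ≠_c | c ∈ ℤ}`. -/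
def lang : FirstOrder.Language where
  Functions := FuncSymb
  Relations := RelSymb

/-- The structure with domain `ℚ_[p]`: addition, the constant `1`, and the valuation constraints.
The valuation `Padic.addValuation` takes values in `ℤ ∪ {∞}` and sends `0` to `∞`. -/
noncomputable instance padicStructure (p : ℕ) [Fact p.Prime] : lang.Structure ℚ_[p] where
  funMap {_} f :=
    match f with
    | FuncSymb.one => fun _ => 1
    | FuncSymb.add => fun x => x 0 + x 1
  RelMap {_} r :=
    match r with
    | RelSymb.valLE c => fun x => Padic.addValuation (x 0) ≤ (c : WithTop ℤ)
    | RelSymb.valGE c => fun x => (c : WithTop ℤ) ≤ Padic.addValuation (x 0)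
    | RelSymb.valEQ c => fun x => Padic.addValuation (x 0) = (c : WithTop ℤ)
    | RelSymb.valNE c => fun x => Padic.addValuation (x 0) ≠ (c : WithTop ℤ)

/-- The substructure of `ℚ_[p]` whose domain is (the canonical image of) `ℚ`. -/
def ratSubstructure (p : ℕ) [Fact p.Prime] : lang.Substructure ℚ_[p] where
  carrier := Set.range ((↑) : ℚ → ℚ_[p])
  fun_mem {_} f :=
    match f with
    | FuncSymb.one => fun _ _ => ⟨1, Rat.cast_one⟩
    | FuncSymb.add => fun x hx => by
        obtain ⟨a, ha⟩ := hx 0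
        obtain ⟨b, hb⟩ := hx 1
        exact ⟨a + b, by rw [Rat.cast_add, ha, hb]; rfl⟩

end PadicLinear

namespace PadicLinear

open FirstOrder FirstOrder.Language

/-! A back-and-forth argument. Terms are affine forms, and an atomic formula sees only whether such
a form vanishes and which of finitely many balls around 0 contain it (`SameScale`). Agreement on
finitely many forms survives adding any element x (`exists_extension`): the partner of x can be a
rational affine form in the other tuple, hence lies in ℚ if that tuple does. The finite data depend
on neither tuple, so induction on formulas passes quantifiers. For sentences no variables remain,
and the forms are rational constants, equal on both sides. -/

/-- Rational affine forms in `n` variables: a linear part and a constant. -/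
abbrev AffineForm (n : ℕ) : Type := (Fin n → ℚ) × ℚ

/-! ### Scales of affine forms and one-point extension -/

section Forms

variable {p : ℕ} [Fact p.Prime]

/-- Evaluation of rational affine forms at a tuple of `p`-adic numbers. -/
noncomputable def evalForm {n : ℕ} (a : Fin n → ℚ_[p]) : AffineForm n →ₗ[ℚ] ℚ_[p] :=
  (Fintype.linearCombination ℚ a).coprod (LinearMap.toSpanSingleton ℚ ℚ_[p] 1)

theorem evalForm_apply {n : ℕ} (a : Fin n → ℚ_[p]) (l : AffineForm n) :
    evalForm a l = ∑ i, l.1 i • a i + (l.2 : ℚ_[p]) := by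
  simp [evalForm, Fintype.linearCombination_apply, Algebra.smul_def]

theorem evalForm_const {n : ℕ} (a : Fin n → ℚ_[p]) (q : ℚ) : evalForm a (0, q) = q := by
  simp [evalForm_apply]

theorem evalForm_single {n : ℕ} (a : Fin n → ℚ_[p]) (i : Fin n) :
    evalForm a (Pi.single i 1, 0) = a i := by
  simp [evalForm_apply, Pi.single_apply]

/-- The part of an affine form not involving the last variable. -/
def AffineForm.init {n : ℕ} (l : AffineForm (n + 1)) : AffineForm n := (Fin.init l.1, l.2)

theorem evalForm_snoc {n : ℕ} (a : Fin n → ℚ_[p]) (x : ℚ_[p]) (l : AffineForm (n + 1)) :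
    evalForm (Fin.snoc a x : Fin (n + 1) → ℚ_[p]) l
      = l.1 (Fin.last n) • x + evalForm a l.init := by
  simp [evalForm_apply, Fin.sum_univ_castSucc, AffineForm.init, Fin.init]
  ring

/-- Two `p`-adic numbers lie in the same balls around `0` with radius `p ^ c`, `|c| ≤ N`. -/
def SameBalls (N : ℕ) (x y : ℚ_[p]) : Prop :=
  ∀ c : ℤ, |c| ≤ N → (‖x‖ ≤ (p : ℝ) ^ c ↔ ‖y‖ ≤ (p : ℝ) ^ c)

/-- `SameBalls`, and the two numbers vanish simultaneously. -/
def SameScale (N : ℕ) (x y : ℚ_[p]) : Prop :=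
  (x = 0 ↔ y = 0) ∧ SameBalls N x y

theorem SameBalls.symm {N : ℕ} {x y : ℚ_[p]} (h : SameBalls N x y) : SameBalls N y x :=
  fun c hc => (h c hc).symm

theorem SameBalls.trans {N : ℕ} {x y z : ℚ_[p]} (h : SameBalls N x y) (h' : SameBalls N y z) :
    SameBalls N x z :=
  fun c hc => (h c hc).trans (h' c hc)

theorem SameBalls.mono {N M : ℕ} (hNM : N ≤ M) {x y : ℚ_[p]} (h : SameBalls M x y) :
    SameBalls N x y :=
  fun c hc => h c (hc.trans (by exact_mod_cast hNM))

theorem SameScale.symm {N : ℕ} {x y : ℚ_[p]} (h : SameScale N x y) : SameScale N y x :=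
  ⟨h.1.symm, h.2.symm⟩

theorem SameScale.mono {N M : ℕ} (hNM : N ≤ M) {x y : ℚ_[p]} (h : SameScale M x y) :
    SameScale N x y :=
  ⟨h.1, h.2.mono hNM⟩

theorem one_lt_cast_prime : (1 : ℝ) < p := mod_cast (Fact.out : p.Prime).one_lt

/-- The difference lies in the smallest ball tested, so the ultrametric inequality applies. -/
theorem sameBalls_of_norm_sub_le {N : ℕ} {x y : ℚ_[p]} (h : ‖x - y‖ ≤ (p : ℝ) ^ (-N : ℤ)) :
    SameBalls N x y := by
  intro c hc
  have hle : ‖x - y‖ ≤ (p : ℝ) ^ c :=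
    h.trans (zpow_le_zpow_right₀ one_lt_cast_prime.le (neg_le_of_abs_le hc))
  constructor
  · intro hx
    have := Padic.nonarchimedean (y - x) x
    rw [sub_add_cancel, norm_sub_rev] at this
    exact this.trans (max_le hle hx)
  · intro hy
    have := Padic.nonarchimedean (x - y) y
    rw [sub_add_cancel] at this
    exact this.trans (max_le hle hy)

theorem norm_ratSmul_le_zpow_iff {α : ℚ} (hα : α ≠ 0) (x : ℚ_[p]) (c : ℤ) :
    ‖α • x‖ ≤ (p : ℝ) ^ c ↔ ‖x‖ ≤ (p : ℝ) ^ (c + (α : ℚ_[p]).valuation) := by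
  have hα' : (α : ℚ_[p]) ≠ 0 := mod_cast hα
  have hp : (0 : ℝ) < p := zero_lt_one.trans one_lt_cast_prime
  rw [Algebra.smul_def, eq_ratCast, norm_mul, Padic.norm_eq_zpow_neg_valuation hα',
    zpow_add₀ hp.ne', zpow_neg, inv_mul_le_iff₀ (zpow_pos hp _), mul_comm]

theorem SameScale.ratSmul {N M : ℕ} {α : ℚ} (hα : α ≠ 0)
    (hM : |(α : ℚ_[p]).valuation| ≤ M) {x y : ℚ_[p]} (h : SameScale (N + M) x y) :
    SameScale N (α • x) (α • y) := by
  refine ⟨by simp [hα, h.1], fun c hc => ?_⟩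
  rw [norm_ratSmul_le_zpow_iff hα, norm_ratSmul_le_zpow_iff hα]
  refine h.2 _ ((abs_add_le _ _).trans ?_)
  push_cast
  exact add_le_add hc hM

/-- Finitely many rational numbers represent all balls of radius `p ^ (-N)` inside the ball of
radius `p ^ N`. -/
theorem exists_finset_rat_approx (N : ℕ) :
    ∃ R : Finset ℚ, ∀ u : ℚ_[p], ‖u‖ ≤ (p : ℝ) ^ (N : ℤ) →
      ∃ r ∈ R, ‖u - r‖ ≤ (p : ℝ) ^ (-N : ℤ) := by
  have hpos : (0 : ℝ) < (p : ℝ) ^ (-N : ℤ) := zpow_pos (zero_lt_one.trans one_lt_cast_prime) _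
  obtain ⟨R, hR⟩ := (isCompact_closedBall (0 : ℚ_[p]) ((p : ℝ) ^ (N : ℤ))).elim_finite_subcover
    (fun r : ℚ => Metric.ball (r : ℚ_[p]) ((p : ℝ) ^ (-N : ℤ))) (fun _ => Metric.isOpen_ball)
    (fun u _ => by
      obtain ⟨r, hr⟩ := Padic.rat_dense p u hpos
      exact Set.mem_iUnion.2 ⟨r, by rwa [Metric.mem_ball, dist_eq_norm]⟩)
  refine ⟨R, fun u hu => ?_⟩
  have := hR (mem_closedBall_zero_iff.2 hu)
  simp only [Set.mem_iUnion, Metric.mem_ball, dist_eq_norm] at this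
  obtain ⟨r, hr, h⟩ := this
  exact ⟨r, hr, h.le⟩

theorem exists_rat_norm_le_notMem (N : ℕ) (s : Finset ℚ_[p]) :
    ∃ y : ℚ, ‖(y : ℚ_[p])‖ ≤ (p : ℝ) ^ (-N : ℤ) ∧ (y : ℚ_[p]) ∉ s := by
  have hinj : Function.Injective fun m : ℕ => (p : ℚ_[p]) ^ (N + m) := by
    intro m m' h
    have := congrArg norm h
    simp only [Padic.norm_p_pow] at this
    have := zpow_right_injective₀ (zero_lt_one.trans one_lt_cast_prime) one_lt_cast_prime.ne' this
    push_cast at this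
    omega
  obtain ⟨_, ⟨m, rfl⟩, hm⟩ := (Set.infinite_range_of_injective hinj).exists_notMem_finset s
  refine ⟨(p : ℚ) ^ (N + m), ?_, by push_cast; exact hm⟩
  push_cast
  rw [Padic.norm_p_pow]
  exact zpow_le_zpow_right₀ one_lt_cast_prime.le (by push_cast; omega)

theorem exists_rat_lt_norm_sub (B : ℝ) (s : Finset ℚ_[p]) :
    ∃ y : ℚ, ∀ t ∈ s, B < ‖(y : ℚ_[p]) - t‖ := by
  obtain ⟨m, hm⟩ := pow_unbounded_of_one_lt (max B (∑ t ∈ s, ‖t‖)) (one_lt_cast_prime (p := p))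
  refine ⟨(p : ℚ) ^ (-m : ℤ), fun t ht => ?_⟩
  by_contra! hle
  have h := Padic.nonarchimedean (((p : ℚ) ^ (-m : ℤ) : ℚ) - t : ℚ_[p]) t
  rw [sub_add_cancel] at h
  have hn : ‖(((p : ℚ) ^ (-m : ℤ) : ℚ) : ℚ_[p])‖ = (p : ℝ) ^ m := by
    push_cast
    rw [Padic.norm_p_zpow, neg_neg, zpow_natCast]
  have ht' : ‖t‖ ≤ ∑ t ∈ s, ‖t‖ :=
    Finset.single_le_sum (f := fun t : ℚ_[p] => ‖t‖) (fun _ _ => norm_nonneg _) ht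
  exact absurd (h.trans (max_le_max hle ht')) (by rw [hn]; exact not_le.2 hm)

open Classical in
/-- Extension step for forms in which the new variable has coefficient one. -/
theorem exists_extension_monic {n : ℕ} (T : Finset (AffineForm n)) (N : ℕ) :
    ∃ L : Finset (AffineForm n), ∀ a a' : Fin n → ℚ_[p],
      (∀ l ∈ L, SameScale N (evalForm a l) (evalForm a' l)) →
      ∀ x : ℚ_[p], ∃ l : AffineForm n, ∀ t ∈ T,
        SameScale N (x - evalForm a t) (evalForm a' l - evalForm a' t) := by
  obtain ⟨R, hR⟩ := exists_finset_rat_approx (p := p) N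
  -- Differences of two roots, shifted by an approximant; the shift 0 serves the case where x is a
  -- root.
  refine ⟨((T ×ˢ T) ×ˢ insert 0 R).image fun w => w.1.1 + (0, w.2) - w.1.2, ?_⟩
  intro a a' h x
  have key : ∀ s ∈ T, ∀ t ∈ T, ∀ r : ℚ, r ∈ insert 0 R →
      SameScale N (evalForm a s + (r : ℚ_[p]) - evalForm a t)
        (evalForm a' s + (r : ℚ_[p]) - evalForm a' t) := by
    intro s hs t ht r hr
    have := h (s + (0, r) - t) (Finset.mem_image.2
      ⟨((s, t), r), Finset.mem_product.2 ⟨Finset.mem_product.2 ⟨hs, ht⟩, hr⟩, rfl⟩)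
    simpa only [map_sub, map_add, evalForm_const] using this
  by_cases hx : ∃ s ∈ T, x = evalForm a s
  · obtain ⟨s, hs, rfl⟩ := hx
    refine ⟨s, fun t ht => ?_⟩
    simpa using key s hs t ht 0 (Finset.mem_insert_self _ _)
  push Not at hx
  by_cases hball : ∃ s ∈ T, ‖x - evalForm a s‖ ≤ (p : ℝ) ^ (N : ℤ)
  · obtain ⟨s, hs, hxs⟩ := hball
    obtain ⟨r, hr, hxr⟩ := hR _ hxs
    -- x is near a root but not a root: the perturbation y, too small to change any ball, keeps the
    -- witness off all roots.
    obtain ⟨y, hy, hyT⟩ := exists_rat_norm_le_notMem N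
      (T.image fun t => evalForm a' t - evalForm a' s - (r : ℚ_[p]))
    refine ⟨s + (0, r + y), fun t ht => ⟨?_, ?_⟩⟩
    · refine iff_of_false (sub_ne_zero.2 (hx t ht)) fun h0 => hyT (Finset.mem_image.2 ⟨t, ht, ?_⟩)
      rw [map_add, evalForm_const, Rat.cast_add] at h0
      linear_combination -h0
    · refine ((sameBalls_of_norm_sub_le ?_).trans
        (key s hs t ht r (Finset.mem_insert_of_mem hr)).2).trans (sameBalls_of_norm_sub_le ?_)
      · convert hxr using 2
        ring
      · rw [norm_sub_rev, map_add, evalForm_const, Rat.cast_add, sub_sub_sub_cancel_right,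
          ← add_assoc, add_sub_cancel_left]
        exact hy
  · push Not at hball
    -- x is far from every root: any constant far from all roots on the other side fails the same
    -- tests.
    obtain ⟨y, hy⟩ := exists_rat_lt_norm_sub ((p : ℝ) ^ (N : ℤ)) (T.image (evalForm a'))
    refine ⟨(0, y), fun t ht => ?_⟩
    have hyt := hy _ (Finset.mem_image_of_mem _ ht)
    have hpos : (0 : ℝ) < (p : ℝ) ^ (N : ℤ) := zpow_pos (zero_lt_one.trans one_lt_cast_prime) _
    rw [evalForm_const]
    refine ⟨iff_of_false (sub_ne_zero.2 (hx t ht)) (norm_pos_iff.1 (hpos.trans hyt)),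
      fun c hc => ?_⟩
    have hcN : (p : ℝ) ^ c ≤ (p : ℝ) ^ (N : ℤ) :=
      zpow_le_zpow_right₀ one_lt_cast_prime.le (le_of_abs_le hc)
    exact iff_of_false (not_le.2 (hcN.trans_lt (hball t ht))) (not_le.2 (hcN.trans_lt hyt))

open Classical in
/-- Tuples with the same scales on a suitable finite set of forms can be extended by one element,
preserving the scales on a given finite set of forms. -/
theorem exists_extension {n : ℕ} (L : Finset (AffineForm (n + 1))) (N : ℕ) :
    ∃ (N' : ℕ) (L' : Finset (AffineForm n)), ∀ a a' : Fin n → ℚ_[p],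
      (∀ l ∈ L', SameScale N' (evalForm a l) (evalForm a' l)) →
      ∀ x : ℚ_[p], ∃ l : AffineForm n, ∀ t ∈ L,
        SameScale N (evalForm (Fin.snoc a x : Fin (n + 1) → ℚ_[p]) t)
          (evalForm (Fin.snoc a' (evalForm a' l) : Fin (n + 1) → ℚ_[p]) t) := by
  -- Dividing by a leading coefficient shifts radii by its valuation; M bounds all these shifts.
  let M : ℕ := ∑ t ∈ L, (t.1 (Fin.last n) : ℚ_[p]).valuation.natAbs
  let root : AffineForm (n + 1) → AffineForm n := fun t => -(t.1 (Fin.last n))⁻¹ • t.init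
  obtain ⟨L', hL'⟩ := exists_extension_monic (p := p) (L.image root) (N + M)
  refine ⟨N + M, L' ∪ L.image AffineForm.init, fun a a' h x => ?_⟩
  obtain ⟨l, hl⟩ := hL' a a' (fun t ht => h t (Finset.mem_union_left _ ht)) x
  refine ⟨l, fun t ht => ?_⟩
  rw [evalForm_snoc, evalForm_snoc]
  by_cases h0 : t.1 (Fin.last n) = 0
  · simpa [h0] using (h t.init (Finset.mem_union_right _ (Finset.mem_image_of_mem _ ht))).mono
      (Nat.le_add_right N M)
  · have hM : |(t.1 (Fin.last n) : ℚ_[p]).valuation| ≤ M := by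
      rw [Int.abs_eq_natAbs]
      exact_mod_cast Finset.single_le_sum
        (f := fun t : AffineForm (n + 1) => (t.1 (Fin.last n) : ℚ_[p]).valuation.natAbs)
        (fun _ _ => Nat.zero_le _) ht
    have := (hl _ (Finset.mem_image_of_mem root ht)).ratSmul h0 hM
    have hroot (b : Fin n → ℚ_[p]) (z : ℚ_[p]) :
        t.1 (Fin.last n) • (z - evalForm b (root t))
          = t.1 (Fin.last n) • z + evalForm b t.init := by
      rw [map_smul, smul_sub, smul_smul, mul_neg, mul_inv_cancel₀ h0, neg_smul, one_smul,
        sub_neg_eq_add]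
    rwa [hroot, hroot] at this

/-! ### Valuation constraints as ball membership -/

theorem coe_le_addValuation_iff (c : ℤ) (x : ℚ_[p]) :
    (c : WithTop ℤ) ≤ Padic.addValuation x ↔ ‖x‖ ≤ (p : ℝ) ^ (-c) := by
  rcases eq_or_ne x 0 with rfl | hx
  · simp only [AddValuation.map_zero, le_top, norm_zero, true_iff]
    exact zpow_nonneg (Nat.cast_nonneg _) _
  · rw [Padic.addValuation.apply hx, WithTop.coe_le_coe, Padic.norm_eq_zpow_neg_valuation hx,
      zpow_le_zpow_iff_right₀ one_lt_cast_prime, neg_le_neg_iff]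

theorem addValuation_le_coe_iff (c : ℤ) (x : ℚ_[p]) :
    Padic.addValuation x ≤ (c : WithTop ℤ) ↔ ¬ ‖x‖ ≤ (p : ℝ) ^ (-(c + 1)) := by
  rw [← coe_le_addValuation_iff]
  cases h : Padic.addValuation x with
  | top => simp
  | coe k =>
    rw [WithTop.coe_le_coe, WithTop.coe_le_coe]
    omega

theorem relMap_iff_of_sameBalls {k : ℕ} (R : lang.Relations k) :
    ∃ N : ℕ, ∀ x y : Fin k → ℚ_[p], (∀ i, SameBalls N (x i) (y i)) →
      (Structure.RelMap R x ↔ Structure.RelMap R y) := by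
  have hGE (c : ℤ) {x y : ℚ_[p]} (h : SameBalls (c.natAbs + 1) x y) :
      (c : WithTop ℤ) ≤ Padic.addValuation x ↔ (c : WithTop ℤ) ≤ Padic.addValuation y := by
    rw [coe_le_addValuation_iff, coe_le_addValuation_iff]
    exact h _ (by push_cast; rw [abs_neg]; omega)
  have hLE (c : ℤ) {x y : ℚ_[p]} (h : SameBalls (c.natAbs + 1) x y) :
      Padic.addValuation x ≤ (c : WithTop ℤ) ↔ Padic.addValuation y ≤ (c : WithTop ℤ) := by
    rw [addValuation_le_coe_iff, addValuation_le_coe_iff]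
    exact not_congr (h _ (by push_cast; rw [abs_neg]; exact (abs_add_le c 1).trans (by simp)))
  match R with
  | RelSymb.valLE c => exact ⟨_, fun x y h => hLE c (h 0)⟩
  | RelSymb.valGE c => exact ⟨_, fun x y h => hGE c (h 0)⟩
  | RelSymb.valEQ c =>
    exact ⟨_, fun x y h => le_antisymm_iff.trans
      ((and_congr (hLE c (h 0)) (hGE c (h 0))).trans le_antisymm_iff.symm)⟩
  | RelSymb.valNE c =>
    exact ⟨_, fun x y h => not_congr (le_antisymm_iff.trans
      ((and_congr (hLE c (h 0)) (hGE c (h 0))).trans le_antisymm_iff.symm))⟩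

end Forms

/-! ### Induction on formulas -/

section Formulas

variable (p : ℕ) [Fact p.Prime]

theorem exists_affineForm_of_term {n : ℕ} (t : lang.Term (Empty ⊕ Fin n)) :
    ∃ l : AffineForm n, ∀ a : Fin n → ℚ_[p],
      t.realize (Sum.elim default a) = evalForm a l := by
  induction t with
  | var i =>
    rcases i with i | i
    · exact i.elim
    · exact ⟨_, fun a => (evalForm_single a i).symm⟩
  | func f ts ih =>
    choose l hl using ih
    cases f with
    | one => exact ⟨(0, 1), fun a => by rw [evalForm_const, Rat.cast_one]; rfl⟩
    | add =>
      refine ⟨l 0 + l 1, fun a => ?_⟩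
      rw [map_add, ← hl, ← hl]
      rfl

variable {p}

/-- An embedded structure is affinely closed if its image is stable under rational affine forms. -/
def AffinelyClosed {M : Type} [lang.Structure M] (f : M ↪[lang] ℚ_[p]) : Prop :=
  ∀ (n : ℕ) (a : Fin n → M) (l : AffineForm n), ∃ y : M, f y = evalForm (f ∘ a) l

theorem comp_elim_default {M : Type} [lang.Structure M] (f : M ↪[lang] ℚ_[p]) {n : ℕ}
    (a : Fin n → M) :
    (f ∘ Sum.elim default a : Empty ⊕ Fin n → ℚ_[p]) = Sum.elim default (f ∘ a) := by
  rw [Sum.comp_elim]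
  congr 1
  exact Subsingleton.elim _ _

theorem comp_snoc {M : Type} [lang.Structure M] (f : M ↪[lang] ℚ_[p]) {n : ℕ}
    (a : Fin n → M) (x : M) :
    f ∘ (Fin.snoc a x : Fin (n + 1) → M) = (Fin.snoc (f ∘ a) (f x) : Fin (n + 1) → ℚ_[p]) :=
  Fin.comp_snoc f a x

/-- The truth of a formula is determined by the scales of finitely many rational affine forms,
uniformly over affinely closed structures. -/
theorem exists_forms_determining {M M' : Type} [lang.Structure M] [lang.Structure M']
    (f : M ↪[lang] ℚ_[p]) (f' : M' ↪[lang] ℚ_[p]) (hf : AffinelyClosed f)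
    (hf' : AffinelyClosed f') {n : ℕ} (φ : lang.BoundedFormula Empty n) :
    ∃ (N : ℕ) (L : Finset (AffineForm n)), ∀ (a : Fin n → M) (a' : Fin n → M'),
      (∀ l ∈ L, SameScale N (evalForm (f ∘ a) l) (evalForm (f' ∘ a') l)) →
      (φ.Realize default a ↔ φ.Realize default a') := by
  classical
  induction φ with
  | falsum => exact ⟨0, ∅, fun _ _ _ => Iff.rfl⟩
  | equal t₁ t₂ =>
    obtain ⟨l₁, h₁⟩ := exists_affineForm_of_term p t₁
    obtain ⟨l₂, h₂⟩ := exists_affineForm_of_term p t₂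
    refine ⟨0, {l₁ - l₂}, fun a a' h => ?_⟩
    have := (h _ (Finset.mem_singleton_self _)).1
    rw [map_sub, map_sub, sub_eq_zero, sub_eq_zero, ← h₁, ← h₂, ← h₁, ← h₂,
      ← comp_elim_default, ← comp_elim_default] at this
    simp only [HomClass.realize_term, f.injective.eq_iff, f'.injective.eq_iff] at this
    exact this
  | rel R ts =>
    obtain ⟨N, hN⟩ := relMap_iff_of_sameBalls (p := p) R
    choose l hl using fun i => exists_affineForm_of_term p (ts i)
    refine ⟨N, Finset.univ.image l, fun a a' h => ?_⟩
    have := hN (fun i => evalForm (f ∘ a) (l i)) (fun i => evalForm (f' ∘ a') (l i))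
      fun i => (h _ (Finset.mem_image_of_mem l (Finset.mem_univ i))).2
    simp only [← hl, ← comp_elim_default, HomClass.realize_term] at this
    exact (f.map_rel R _).symm.trans (this.trans (f'.map_rel R _))
  | imp φ ψ ih₁ ih₂ =>
    obtain ⟨N₁, L₁, h₁⟩ := ih₁
    obtain ⟨N₂, L₂, h₂⟩ := ih₂
    refine ⟨max N₁ N₂, L₁ ∪ L₂, fun a a' h => ?_⟩
    exact imp_congr
      (h₁ a a' fun l hl => (h l (Finset.mem_union_left _ hl)).mono (le_max_left _ _))
      (h₂ a a' fun l hl => (h l (Finset.mem_union_right _ hl)).mono (le_max_right _ _))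
  | all φ ih =>
    obtain ⟨N, L, hL⟩ := ih
    obtain ⟨N', L', hL'⟩ := exists_extension (p := p) L N
    refine ⟨N', L', fun a a' h => ⟨fun hφ x' => ?_, fun hφ x => ?_⟩⟩
    -- `L'` is uniform in both tuples, so the extension also runs backwards; affine closedness puts
    -- the witness in `M`.
    · obtain ⟨l, hl⟩ := hL' _ _ (fun t ht => (h t ht).symm) (f' x')
      obtain ⟨x, hx⟩ := hf _ a l
      refine (hL (Fin.snoc a x) (Fin.snoc a' x') fun t ht => ?_).1 (hφ x)
      rw [comp_snoc, comp_snoc, hx]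
      exact (hl t ht).symm
    · obtain ⟨l, hl⟩ := hL' _ _ h (f x)
      obtain ⟨x', hx'⟩ := hf' _ a' l
      refine (hL (Fin.snoc a x) (Fin.snoc a' x') fun t ht => ?_).2 (hφ x')
      rw [comp_snoc, comp_snoc, hx']
      exact hl t ht

theorem affinelyClosed_refl : AffinelyClosed (Embedding.refl lang ℚ_[p]) :=
  fun _ a l => ⟨evalForm a l, rfl⟩

theorem affinelyClosed_ratSubstructure : AffinelyClosed (ratSubstructure p).subtype := by
  intro n a l
  choose q hq using fun i => (a i).2
  refine ⟨⟨_, ∑ i, l.1 i * q i + l.2, rfl⟩, ?_⟩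
  rw [evalForm_apply]
  simp only [Substructure.subtype_apply, Function.comp_apply, ← hq, Algebra.smul_def, eq_ratCast]
  push_cast
  rfl

end Formulas

end PadicLinear

theorem proposition3p1 (p : ℕ) [Fact p.Prime] :
    ℚ_[p] ≅[PadicLinear.lang] PadicLinear.ratSubstructure p := by
  rw [FirstOrder.Language.elementarilyEquivalent_iff]
  intro φ
  obtain ⟨N, L, h⟩ := PadicLinear.exists_forms_determining _ _ PadicLinear.affinelyClosed_refl
    (PadicLinear.affinelyClosed_ratSubstructure (p := p)) φ
  have key := h default default fun l _ => ?_
  · unfold FirstOrder.Language.Sentence.Realize FirstOrder.Language.Formula.Realize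
    convert key
  rw [Subsingleton.elim (FirstOrder.Language.Embedding.refl PadicLinear.lang ℚ_[p] ∘ default)
    ((PadicLinear.ratSubstructure p).subtype ∘ default)]
  exact ⟨Iff.rfl, fun _ _ => Iff.rfl⟩
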